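/- Let $n\ge 0$ be an integer. Let $\Gamma=\bigoplus_{m\ge0}(\mathbb C^n)^{\otimes m}$ be the full Fock space with its orthonormal basis $e_\alpha$ indexed by the words $\alpha$ in the letters $1,\dots,n$, and let $S_1,\dots,S_n$ be the left creation operators, $S_je_\alpha=e_{j\alpha}$. For complex Hilbert spaces $\mathcal E,\mathcal F$, a contractive multi-analytic operator is a linear contraction $\Theta:\Gamma\otimes\mathcal E\to\Gamma\otimes\mathcal F$ with $\Theta(S_j\otimes I_{\mathcal E})=(S_j\otimes I_{\mathcal F})\Theta$ for all $j$. It is purely contractive if $\|P\,\Theta(e_\emptyset\otimes h)\|<\|h\|$ for all $0\ne h\in\mathcal E$, where $P$ is the projection onto $e_\emptyset\otimes\mathcal F$. Put $\Delta_\Theta=(I-\Theta^*\Theta)^{1/2}$ and $\mathcal D_\Theta=\overline{\Delta_\Theta(\Gamma\otimes\mathcal E)}$. Let $C_j=C_j^{\Theta}$ be the isometry of $\mathcal D_\Theta$ with $C_j\Delta_\Theta f=\Delta_\Theta(S_j\otimes I)f$. The model space and the model operators $T_\Theta=[T_{\Theta,1},\dots,T_{\Theta,n}]$ of $\Theta$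 are $$\mathcal H(\Theta)=\big[(\Gamma\otimes\mathcal F)\oplus\mathcal D_\Theta\big]\ominus\mathcal G_\Theta,\qquad \mathcal G_\Theta=\{\Theta w\oplus\Delta_\Theta w: w\in\Gamma\otimes\mathcal E\},\qquad T_{\Theta,j}^*(f\oplus g)=(S_j^*\otimes I)f\oplus C_j^*g .$$ Let $k\ge2$, let $\mathcal E_1,\dots,\mathcal E_{k+1}$ be complex Hilbert spaces, let $\Theta_i:\Gamma\otimes\mathcal E_i\to\Gamma\otimes\mathcal E_{i+1}$ $(i=1,\dots,k)$ be contractive multi-analytic operators, and put $\Theta=\Theta_k\cdots\Theta_1$ and $\Delta_i=\Delta_{\Theta_i}$. Suppose that the factorization is $k$-regular, that is, the isometry $$Z_k:\mathcal D_\Theta\to\mathcal D_{\Theta_k}\oplus\cdots\oplus\mathcal D_{\Theta_1},\qquad Z_k\Delta_\Theta f=\Delta_k\Theta_{k-1}\cdots\Theta_1f\oplus\cdots\oplus\Delta_2\Theta_1 f\oplus\Delta_1f,$$ is unitary. Suppose moreover that $\Theta$ is purely contractive and satisfies the Szegő condition $\overline{\Delta_\Theta(\Gamma\otimes\mathcal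 E_1)}=\overline{\Delta_\Theta[(\Gamma\otimes\mathcal E_1)\ominus(e_\emptyset\otimes\mathcal E_1)]}$. For $i=1,\dots,k-1$ let $$\mathcal M_i=\Big\{\Theta_k\cdots\Theta_{i+1}f\oplus Z_k^*\big(\Delta_k\Theta_{k-1}\cdots\Theta_{i+1}f\oplus\cdots\oplus\Delta_{i+1}f\oplus g_i\oplus\cdots\oplus g_1\big): f\in\Gamma\otimes\mathcal E_{i+1},\ g_l\in\mathcal D_{\Theta_l}\Big\}\ominus\mathcal G_\Theta ,$$ and put $\mathcal M_0=\{0\}$, $\mathcal M_k=\mathcal H(\Theta)$ and $\mathcal H_i=\mathcal M_i\ominus\mathcal M_{i-1}$ for $i=1,\dots,k$. Then $T_\Theta$ is a row contraction, i.e. $\sum_jT_{\Theta,j}T_{\Theta,j}^*\le I$; $\mathcal M_1\subseteq\cdots\subseteq\mathcal M_{k-1}$ are closed subspaces of $\mathcal H(\Theta)$, invariant under every $T_{\Theta,j}$; $\mathcal H(\Theta)=\mathcal H_1\oplus\cdots\oplus\mathcal H_k$ is an orthogonal decomposition; and with respect to it each $T_{\Theta,j}$ is block upper triangular, i.e. $P_{\mathcal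 H_i}T_{\Theta,j}|_{\mathcal H_l}=0$ for $l<i$. Moreover, for each $i=1,\dots,k$, the diagonal blocks $A_j^i=P_{\mathcal H_i}T_{\Theta,j}|_{\mathcal H_i}$ form a row contraction $A^i=[A_1^i,\dots,A_n^i]$ that is unitarily equivalent to $T_{\Theta_i}=[T_{\Theta_i,1},\dots,T_{\Theta_i,n}]$: there is one unitary $U_i:\mathcal H_i\to\mathcal H(\Theta_i)$ with $U_iA_j^i=T_{\Theta_i,j}U_i$ for all $j=1,\dots,n$. -/

import Mathlib

open scoped InnerProductSpace

noncomputable section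

namespace MultiAnalytic

/-! ### Fock space and creation operators -/

/-- The Hilbert space `Γ ⊗ E`, where `Γ` is the full Fock space over `ℂⁿ`.  The words `α` in the
letters `Fin n` index the orthonormal basis `e_α` of `Γ`, so that `Γ ⊗ E = ⨁_α e_α ⊗ E` is the space
of square summable families `(f_α)` in `E`; the family `f` stands for `∑_α e_α ⊗ f_α`. -/
def Fock (n : ℕ) (E : Type*) [NormedAddCommGroup E] : Type _ :=
  lp (fun _ : List (Fin n) => E) 2

instance (n : ℕ) (E : Type*) [NormedAddCommGroup E] : NormedAddCommGroup (Fock n E) :=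
  inferInstanceAs (NormedAddCommGroup (lp (fun _ : List (Fin n) => E) 2))

instance (n : ℕ) (E : Type*) [NormedAddCommGroup E] [InnerProductSpace ℂ E] :
    InnerProductSpace ℂ (Fock n E) :=
  inferInstanceAs (InnerProductSpace ℂ (lp (fun _ : List (Fin n) => E) 2))

instance (n : ℕ) (E : Type*) [NormedAddCommGroup E] [CompleteSpace E] :
    CompleteSpace (Fock n E) :=
  inferInstanceAs (CompleteSpace (lp (fun _ : List (Fin n) => E) 2))

/-- The coefficients `f_α` of `f = ∑_α e_α ⊗ f_α`. -/
def Fock.coeff {n : ℕ} {E : Type*} [NormedAddCommGroup E] (f : Fock n E) : List (Fin n) → E :=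
  Subtype.val f

section Creation

variable {n : ℕ} {E : Type*} [NormedAddCommGroup E]

/-- The family with value `f_β` at the word `jβ`, and `0` at all words not starting with `j`. -/
def shift (j : Fin n) (f : List (Fin n) → E) : List (Fin n) → E
  | [] => 0
  | i :: β => if i = j then f β else 0

lemma norm_shift_rpow (j : Fin n) (f : List (Fin n) → E) :
    (fun α => ‖shift j f α‖ ^ (2 : ENNReal).toReal) =
      Function.extend (List.cons j) (fun β => ‖f β‖ ^ (2 : ENNReal).toReal) 0 := by
  have hinj : Function.Injective (List.cons j) := List.cons_injective
  funext α
  by_cases hα : ∃ β, List.cons j β = α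
  · obtain ⟨β, rfl⟩ := hα
    rw [hinj.extend_apply]; simp [shift]
  · rw [Function.extend_apply' _ _ _ hα]
    cases α with
    | nil => simp [shift]
    | cons i β =>
      have : i ≠ j := fun h => hα ⟨β, by rw [h]⟩
      simp [shift, this]

lemma hasSum_shift (j : Fin n) (f : Fock n E) :
    HasSum (fun α => ‖shift j f.coeff α‖ ^ (2 : ENNReal).toReal) (‖f‖ ^ (2 : ENNReal).toReal) := by
  rw [norm_shift_rpow]
  exact (hasSum_extend_zero List.cons_injective).2 (lp.hasSum_norm (E := fun _ : List (Fin n) => E) (by norm_num) f)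

lemma memℓp_shift (j : Fin n) (f : Fock n E) : Memℓp (shift j f.coeff) 2 :=
  (memℓp_gen_iff (by norm_num)).2 (hasSum_shift j f).summable

/-- The left creation operator `S_j ⊗ I_E`: it sends `e_β ⊗ x` to `e_{jβ} ⊗ x`. -/
def creation (E : Type*) [NormedAddCommGroup E] [InnerProductSpace ℂ E] (j : Fin n) :
    Fock n E →ₗᵢ[ℂ] Fock n E where
  toFun f := ⟨shift j f.coeff, memℓp_shift j f⟩
  map_add' f g := by
    refine Subtype.ext (funext fun α => ?_)
    cases α with
    | nil => exact (add_zero (0 : E)).symm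
    | cons i β =>
      change (if i = j then f.coeff β + g.coeff β else 0) =
        (if i = j then f.coeff β else 0) + if i = j then g.coeff β else 0
      split_ifs <;> simp
  map_smul' c f := by
    refine Subtype.ext (funext fun α => ?_)
    cases α with
    | nil => exact (smul_zero c).symm
    | cons i β =>
      change (if i = j then c • f.coeff β else 0) = c • if i = j then f.coeff β else 0
      split_ifs <;> simp
  norm_map' f := by
    have h2 : 0 < (2 : ENNReal).toReal := by norm_num
    have h := (lp.hasSum_norm (E := fun _ : List (Fin n) => E) h2 (⟨shift j f.coeff, memℓp_shift j f⟩ : Fock n E)).unique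
      (hasSum_shift j f)
    exact (Real.rpow_left_inj (norm_nonneg _) (norm_nonneg _) h2.ne').1 h

/-- The embedding `x ↦ e_∅ ⊗ x` of `E` into `Γ ⊗ E`. -/
def vacuum (n : ℕ) (E : Type*) [NormedAddCommGroup E] [InnerProductSpace ℂ E] :
    E →ₗ[ℂ] Fock n E :=
  lp.lsingle (E := fun _ : List (Fin n) => E) 2 []

end Creation

/-! ### Orthogonal sums of two Hilbert spaces -/

section HSum

variable (H K : Type*) [NormedAddCommGroup H] [InnerProductSpace ℂ H]
  [NormedAddCommGroup K] [InnerProductSpace ℂ K]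

/-- The Hilbert space `H ⊕ K`. -/
def HSum : Type _ := WithLp 2 (H × K)

instance : NormedAddCommGroup (HSum H K) := inferInstanceAs (NormedAddCommGroup (WithLp 2 (H × K)))

instance : InnerProductSpace ℂ (HSum H K) :=
  inferInstanceAs (InnerProductSpace ℂ (WithLp 2 (H × K)))

instance [CompleteSpace H] [CompleteSpace K] : CompleteSpace (HSum H K) :=
  inferInstanceAs (CompleteSpace (WithLp 2 (H × K)))

/-- The pair `(x, y)`, as the element `x ⊕ y` of `H ⊕ K`. -/
def HSum.mk : (H × K) ≃L[ℂ] HSum H K := (WithLp.prodContinuousLinearEquiv 2 ℂ H K).symm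

variable {H K}

lemma HSum.inner_mk (p q : H × K) :
    ⟪HSum.mk H K p, HSum.mk H K q⟫_ℂ = ⟪p.1, q.1⟫_ℂ + ⟪p.2, q.2⟫_ℂ := rfl

lemma HSum.norm_mk_sq (p : H × K) : ‖HSum.mk H K p‖ ^ 2 = ‖p.1‖ ^ 2 + ‖p.2‖ ^ 2 :=
  WithLp.prod_norm_sq_eq_of_L2 (WithLp.toLp 2 p)

end HSum

/-! ### Finite orthogonal sums of Hilbert spaces -/

section HPi

universe v

variable {ι : Type} [Fintype ι] (G : ι → Type v) [∀ i, NormedAddCommGroup (G i)]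
  [∀ i, InnerProductSpace ℂ (G i)]

/-- The Hilbert space `⨁ G_i`. -/
def HPi : Type v := PiLp 2 G

instance : NormedAddCommGroup (HPi G) := inferInstanceAs (NormedAddCommGroup (PiLp 2 G))

instance : InnerProductSpace ℂ (HPi G) := inferInstanceAs (InnerProductSpace ℂ (PiLp 2 G))

instance [∀ i, CompleteSpace (G i)] : CompleteSpace (HPi G) :=
  inferInstanceAs (CompleteSpace (PiLp 2 G))

/-- The family `(g_i)`, as an element of `⨁ G_i`. -/
def HPi.mk : (∀ i, G i) ≃L[ℂ] HPi G := (PiLp.continuousLinearEquiv 2 ℂ G).symm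

variable {G}

lemma HPi.inner_mk (g h : ∀ i, G i) :
    ⟪HPi.mk G g, HPi.mk G h⟫_ℂ = ∑ i, ⟪g i, h i⟫_ℂ := rfl

lemma HPi.norm_mk_sq (g : ∀ i, G i) : ‖HPi.mk G g‖ ^ 2 = ∑ i, ‖g i‖ ^ 2 :=
  PiLp.norm_sq_eq_of_L2 G (WithLp.toLp 2 g)

end HPi

/-! ### Defect operators -/

section Defect

variable {H K : Type*} [NormedAddCommGroup H] [InnerProductSpace ℂ H] [CompleteSpace H]
  [NormedAddCommGroup K] [InnerProductSpace ℂ K] [CompleteSpace K]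

/-- The defect operator `Δ_A = (I - A* A)^{1/2}` of a contraction `A`. -/
def defect (A : H →L[ℂ] K) : H →L[ℂ] H :=
  CFC.sqrt (1 - A.adjoint ∘L A)

lemma norm_defect_sq (A : H →L[ℂ] K) (hA : ‖A‖ ≤ 1) (x : H) :
    ‖defect A x‖ ^ 2 = ‖x‖ ^ 2 - ‖A x‖ ^ 2 := by
  have hre : ∀ y : H, ⟪(1 - A.adjoint ∘L A) y, y⟫_ℂ = ((‖y‖ ^ 2 - ‖A y‖ ^ 2 : ℝ) : ℂ) := by
    intro y
    rw [sub_apply, inner_sub_left, ContinuousLinearMap.comp_apply,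
      ContinuousLinearMap.adjoint_inner_left, ContinuousLinearMap.one_def,
      ContinuousLinearMap.id_apply,
      inner_self_eq_norm_sq_to_K, inner_self_eq_norm_sq_to_K]
    push_cast
    rfl
  have hpos : (0 : H →L[ℂ] H) ≤ 1 - A.adjoint ∘L A := by
    rw [ContinuousLinearMap.nonneg_iff_isPositive, ContinuousLinearMap.isPositive_iff_complex]
    intro y
    have h1 : ‖A y‖ ≤ ‖y‖ := by
      simpa using A.le_of_opNorm_le hA y
    have h2 : ‖A y‖ ^ 2 ≤ ‖y‖ ^ 2 := by gcongr
    rw [hre y]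
    exact ⟨by rw [RCLike.re_to_complex, Complex.ofReal_re],
      by rw [RCLike.re_to_complex, Complex.ofReal_re]; linarith⟩
  have hsq : defect A * defect A = 1 - A.adjoint ∘L A := CFC.sqrt_mul_sqrt_self _ hpos
  have hsa : IsSelfAdjoint (defect A) := IsSelfAdjoint.of_nonneg (CFC.sqrt_nonneg _)
  have h3 : ⟪defect A x, defect A x⟫_ℂ = ((‖x‖ ^ 2 - ‖A x‖ ^ 2 : ℝ) : ℂ) := by
    have h4 := ContinuousLinearMap.adjoint_inner_left (defect A) x (defect A x)
    rw [hsa.adjoint_eq] at h4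
    rw [← hre x, ← hsq]
    exact h4.symm
  have h5 := inner_self_eq_norm_sq_to_K (𝕜 := ℂ) (defect A x)
  rw [h3] at h5
  exact (Complex.ofReal_injective (by rw [h5]; push_cast; rfl)).symm

/-- The closure of the range of `Δ_A`. -/
def defectClosure (A : H →L[ℂ] K) : Submodule ℂ H :=
  (LinearMap.range (defect A).toLinearMap).topologicalClosure

/-- The defect space: the closure of the range of `Δ_A`, as a Hilbert space. -/
def DefectSpace (A : H →L[ℂ] K) : Type _ := defectClosure A

instance (A : H →L[ℂ] K) : NormedAddCommGroup (DefectSpace A) :=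
  inferInstanceAs (NormedAddCommGroup (defectClosure A))

instance (A : H →L[ℂ] K) : InnerProductSpace ℂ (DefectSpace A) :=
  inferInstanceAs (InnerProductSpace ℂ (defectClosure A))

instance (A : H →L[ℂ] K) : CompleteSpace (DefectSpace A) :=
  (Submodule.isClosed_topologicalClosure
    (LinearMap.range (defect A).toLinearMap)).completeSpace_coe

/-- The inclusion of the defect space. -/
def defectIncl (A : H →L[ℂ] K) : DefectSpace A →ₗᵢ[ℂ] H := (defectClosure A).subtypeₗᵢ

/-- `Δ_A`, regarded as a map into the defect space. -/
def defectMap (A : H →L[ℂ] K) : H →ₗ[ℂ] DefectSpace A :=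
  (defect A).toLinearMap.codRestrict (defectClosure A) fun x =>
    Submodule.le_topologicalClosure _ (LinearMap.mem_range_self _ x)

@[simp] lemma defectIncl_defectMap (A : H →L[ℂ] K) (x : H) :
    defectIncl A (defectMap A x) = defect A x := rfl

lemma norm_defectMap_sq (A : H →L[ℂ] K) (hA : ‖A‖ ≤ 1) (x : H) :
    ‖defectMap A x‖ ^ 2 = ‖x‖ ^ 2 - ‖A x‖ ^ 2 :=
  norm_defect_sq A hA x

lemma denseRange_defectMap (A : H →L[ℂ] K) : DenseRange (defectMap A) := by
  have h : DenseRange fun x : H => (⟨defect A x, Submodule.le_topologicalClosure _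
      (LinearMap.mem_range_self (defect A).toLinearMap x)⟩ : defectClosure A) := by
    intro y
    rw [closure_subtype, ← Set.range_comp]
    exact y.2
  exact h

end Defect

/-! ### Multi-analytic operators -/

/-- A contractive multi-analytic operator `Γ ⊗ E → Γ ⊗ F`: a linear contraction that intertwines the
left creation operators. -/
structure Op (n : ℕ) (E F : Type*) [NormedAddCommGroup E] [InnerProductSpace ℂ E]
    [NormedAddCommGroup F] [InnerProductSpace ℂ F] where
  toCLM : Fock n E →L[ℂ] Fock n F
  intertwines : ∀ (j : Fin n) (f : Fock n E),
    toCLM (creation E j f) = creation F j (toCLM f)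
  norm_le_one : ‖toCLM‖ ≤ 1

namespace Op

variable {n : ℕ} {E F G : Type*}
  [NormedAddCommGroup E] [InnerProductSpace ℂ E]
  [NormedAddCommGroup F] [InnerProductSpace ℂ F]
  [NormedAddCommGroup G] [InnerProductSpace ℂ G]

/-- The identity of `Γ ⊗ E`. -/
def one : Op n E E where
  toCLM := ContinuousLinearMap.id ℂ _
  intertwines _ _ := rfl
  norm_le_one := ContinuousLinearMap.norm_id_le

/-- The product `B A`. -/
def comp (B : Op n F G) (A : Op n E F) : Op n E G where
  toCLM := B.toCLM ∘L A.toCLM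
  intertwines j f := by simp [A.intertwines, B.intertwines]
  norm_le_one := (ContinuousLinearMap.opNorm_comp_le _ _).trans
    (mul_le_one₀ B.norm_le_one (norm_nonneg _) A.norm_le_one)

/-- Purely contractive: `‖P_F Θ (e_∅ ⊗ h)‖ < ‖h‖` for all `h ≠ 0`, where `P_F` is the projection onto
`e_∅ ⊗ F`, that is, the coordinate at the empty word. -/
def PurelyContractive (Θ : Op n E F) : Prop :=
  ∀ h : E, h ≠ 0 → ‖(Θ.toCLM (vacuum n E h)).coeff []‖ < ‖h‖

variable [CompleteSpace E] [CompleteSpace F]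

/-- The Szegő condition: `Δ_Θ (Γ ⊗ E)` and `Δ_Θ ((Γ ⊗ E) ⊖ E)` have the same closure, `E` being
identified with `e_∅ ⊗ E`. -/
def Szego (Θ : Op n E F) : Prop :=
  defectClosure Θ.toCLM =
    ((LinearMap.range (vacuum n E))ᗮ.map (defect Θ.toCLM).toLinearMap).topologicalClosure

/-- The row isometry `C = [C_1, …, C_n]` on the defect space, the continuous extension of
`C_j (Δ_Θ f) = Δ_Θ (S_j ⊗ I) f`. -/
def rowIsometry (Θ : Op n E F) (j : Fin n) :
    DefectSpace Θ.toCLM →L[ℂ] DefectSpace Θ.toCLM :=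
  (defectMap Θ.toCLM ∘ₗ (creation E j).toLinearMap).extendOfNorm (defectMap Θ.toCLM)

lemma norm_defectMap_creation (Θ : Op n E F) (j : Fin n) (f : Fock n E) :
    ‖defectMap Θ.toCLM (creation E j f)‖ = ‖defectMap Θ.toCLM f‖ := by
  rw [← sq_eq_sq₀ (norm_nonneg _) (norm_nonneg _), norm_defectMap_sq _ Θ.norm_le_one,
    norm_defectMap_sq _ Θ.norm_le_one, Θ.intertwines, LinearIsometry.norm_map,
    LinearIsometry.norm_map]

lemma rowIsometry_defectMap (Θ : Op n E F) (j : Fin n) (f : Fock n E) :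
    Θ.rowIsometry j (defectMap Θ.toCLM f) = defectMap Θ.toCLM (creation E j f) :=
  LinearMap.extendOfNorm_eq (denseRange_defectMap _)
    ⟨1, fun x => by
      rw [one_mul]
      exact (Θ.norm_defectMap_creation j x).le⟩ f

/-! ### The functional model -/

/-- The space `(Γ ⊗ F) ⊕ closure (Δ_Θ (Γ ⊗ E))`. -/
abbrev Ambient (Θ : Op n E F) : Type _ := HSum (Fock n F) (DefectSpace Θ.toCLM)

/-- The map `w ↦ Θ w ⊕ Δ_Θ w`. -/
def graphMap (Θ : Op n E F) : Fock n E →ₗ[ℂ] Θ.Ambient :=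
  (HSum.mk (Fock n F) (DefectSpace Θ.toCLM)).toLinearMap ∘ₗ
    Θ.toCLM.toLinearMap.prod (defectMap Θ.toCLM)

/-- The subspace `G_Θ = {Θ w ⊕ Δ_Θ w : w ∈ Γ ⊗ E}`. -/
def graph (Θ : Op n E F) : Submodule ℂ Θ.Ambient := LinearMap.range Θ.graphMap

/-- The model space `H(Θ)`, the orthogonal complement of `G_Θ` in the ambient space. -/
def modelSpace (Θ : Op n E F) : Submodule ℂ Θ.Ambient := Θ.graphᗮ

instance (Θ : Op n E F) : CompleteSpace Θ.modelSpace :=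
  inferInstanceAs (CompleteSpace (Θ.graphᗮ : Submodule ℂ Θ.Ambient))

/-- The operator `f ⊕ g ↦ (S_j* ⊗ I) f ⊕ C_j* g` on the ambient space. -/
def ambientAdjoint (Θ : Op n E F) (j : Fin n) : Θ.Ambient →L[ℂ] Θ.Ambient :=
  (HSum.mk (Fock n F) (DefectSpace Θ.toCLM)).toContinuousLinearMap
    ∘L ((creation F j).toContinuousLinearMap.adjoint.prodMap (Θ.rowIsometry j).adjoint)
    ∘L (HSum.mk (Fock n F) (DefectSpace Θ.toCLM)).symm.toContinuousLinearMap

lemma ambientAdjoint_mem (Θ : Op n E F) (j : Fin n) {x : Θ.Ambient} (hx : x ∈ Θ.modelSpace) :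
    Θ.ambientAdjoint j x ∈ Θ.modelSpace := by
  rw [modelSpace, Submodule.mem_orthogonal] at hx ⊢
  obtain ⟨p, rfl⟩ := (HSum.mk (Fock n F) (DefectSpace Θ.toCLM)).surjective x
  rintro _ ⟨w, rfl⟩
  have h : ⟪Θ.toCLM (creation E j w), p.1⟫_ℂ +
    ⟪defectMap Θ.toCLM (creation E j w), p.2⟫_ℂ = 0 := hx _ ⟨creation E j w, rfl⟩
  rw [Θ.intertwines, ← rowIsometry_defectMap] at h
  change ⟪Θ.toCLM w, (creation F j).toContinuousLinearMap.adjoint p.1⟫_ℂ +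
    ⟪defectMap Θ.toCLM w, (Θ.rowIsometry j).adjoint p.2⟫_ℂ = 0
  rw [ContinuousLinearMap.adjoint_inner_right, ContinuousLinearMap.adjoint_inner_right]
  exact h

/-- The operator `T_{Θ,j}*` on `H(Θ)`, given by `f ⊕ g ↦ (S_j* ⊗ I) f ⊕ C_j* g`. -/
def modelAdjoint (Θ : Op n E F) (j : Fin n) : Θ.modelSpace →L[ℂ] Θ.modelSpace :=
  (Θ.ambientAdjoint j ∘L Θ.modelSpace.subtypeL).codRestrict Θ.modelSpace fun x =>
    Θ.ambientAdjoint_mem j x.2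

/-- The model operators `T_Θ = [T_{Θ,1}, …, T_{Θ,n}]` on `H(Θ)`. -/
def model (Θ : Op n E F) (j : Fin n) : Θ.modelSpace →L[ℂ] Θ.modelSpace :=
  ContinuousLinearMap.adjoint (Θ.modelAdjoint j)

end Op

/-! ### Tuples of operators -/

/-- `[T_1, …, T_n]` is a row contraction: `∑ T_j T_j* ≤ I`. -/
def IsRowContraction {n : ℕ} {H : Type*} [NormedAddCommGroup H] [InnerProductSpace ℂ H]
    [CompleteSpace H] (T : Fin n → H →L[ℂ] H) : Prop :=
  ∑ j, T j ∘L (T j).adjoint ≤ 1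

/-- Two `n`-tuples of operators are unitarily equivalent through one unitary. -/
def UnitarilyEquivalent {n : ℕ} {H K : Type*} [NormedAddCommGroup H] [InnerProductSpace ℂ H]
    [NormedAddCommGroup K] [InnerProductSpace ℂ K]
    (S : Fin n → H →L[ℂ] H) (T : Fin n → K →L[ℂ] K) : Prop :=
  ∃ U : H ≃ₗᵢ[ℂ] K, ∀ (j : Fin n) (x : H), U (S j x) = T j (U x)

/-! ### Factorizations -/

section Chain

universe u

/-- Contractive multi-analytic factors `Θ_1, …, Θ_k`, `Θ_i : Γ ⊗ E_i → Γ ⊗ E_{i+1}`.  All indices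
are shifted by one: the factor `Θ_{i+1}` is `F i`, and the space `E_{i+1}` is `E i`. -/
abbrev Chain (n k : ℕ) (E : Fin (k + 1) → Type u) [∀ i, NormedAddCommGroup (E i)]
    [∀ i, InnerProductSpace ℂ (E i)] : Type u :=
  ∀ i : Fin k, Op n (E i.castSucc) (E i.succ)

variable {n k : ℕ} {E : Fin (k + 1) → Type u} [∀ i, NormedAddCommGroup (E i)]
  [∀ i, InnerProductSpace ℂ (E i)]

namespace Chain

/-- The product `F (m-1) ⋯ F a`, by recursion on `m ≥ a`. -/
def prodAux (F : Chain n k E) (a : Fin (k + 1)) {m : ℕ} (h : a.1 ≤ m) :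
    (hm : m < k + 1) → Op n (E a) (E ⟨m, hm⟩) :=
  Nat.leRec (motive := fun m _ => (hm : m < k + 1) → Op n (E a) (E ⟨m, hm⟩))
    (fun _ => Op.one)
    (fun m _ p hm => (F ⟨m, Nat.succ_lt_succ_iff.1 hm⟩).comp (p (Nat.lt_of_succ_lt hm))) h

/-- The product `F (b-1) ⋯ F a`, from `Γ ⊗ E a` to `Γ ⊗ E b`. -/
def prod (F : Chain n k E) (a b : Fin (k + 1)) (h : a ≤ b) : Op n (E a) (E b) :=
  F.prodAux a h b.2

lemma prod_self (F : Chain n k E) (a : Fin (k + 1)) : F.prod a a le_rfl = Op.one := by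
  unfold prod prodAux
  rw [Nat.leRec_self]

lemma prod_succ (F : Chain n k E) (a : Fin (k + 1)) (i : Fin k) (h : a ≤ i.castSucc) :
    F.prod a i.succ (h.trans (Fin.castSucc_le_succ i)) = (F i).comp (F.prod a i.castSucc h) := by
  unfold prod prodAux
  exact congrFun (Nat.leRec_succ (n := a.1) (m := i.1)
    (motive := fun m _ => (hm : m < k + 1) → Op n (E a) (E ⟨m, hm⟩)) _ _ h) i.succ.2

/-- The product `Θ_k ⋯ Θ_1` of all factors. -/
def total (F : Chain n k E) : Op n (E 0) (E (Fin.last k)) :=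
  F.prod 0 (Fin.last k) (Fin.zero_le _)

variable [∀ i, CompleteSpace (E i)]

/-- The sum of the defect spaces of the factors. -/
abbrev DefectSum (F : Chain n k E) : Type u :=
  HPi fun i : Fin k => DefectSpace (F i).toCLM

/-- The family `(g_i)` with `g_i` in the defect space of `F i`, as an element of the sum. -/
abbrev mkSum (F : Chain n k E) : (∀ i, DefectSpace (F i).toCLM) ≃L[ℂ] F.DefectSum :=
  HPi.mk fun i : Fin k => DefectSpace (F i).toCLM

/-- The map sending `f ∈ Γ ⊗ E a` to the family with the entries `Δ_{F i} F (i-1) ⋯ F a f` for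
`i ≥ a`, and `0` for `i < a`. -/
def defectFam (F : Chain n k E) (a : Fin (k + 1)) :
    Fock n (E a) →ₗ[ℂ] ∀ i, DefectSpace (F i).toCLM :=
  LinearMap.pi fun i =>
    if h : a ≤ i.castSucc then defectMap (F i).toCLM ∘ₗ (F.prod a i.castSucc h).toCLM.toLinearMap
    else 0

lemma defectFam_of_le (F : Chain n k E) (a : Fin (k + 1)) (f : Fock n (E a)) (i : Fin k)
    (h : a ≤ i.castSucc) :
    F.defectFam a f i = defectMap (F i).toCLM ((F.prod a i.castSucc h).toCLM f) := by
  rw [defectFam, LinearMap.pi_apply, dif_pos h]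
  rfl

lemma defectFam_of_not_le (F : Chain n k E) (a : Fin (k + 1)) (f : Fock n (E a)) (i : Fin k)
    (h : ¬ a ≤ i.castSucc) : F.defectFam a f i = 0 := by
  rw [defectFam, LinearMap.pi_apply, dif_neg h]
  rfl

/-- `defectFam`, as a map into the Hilbert space sum of the defect spaces. -/
def defectVec (F : Chain n k E) (a : Fin (k + 1)) : Fock n (E a) →ₗ[ℂ] F.DefectSum :=
  F.mkSum.toLinearMap ∘ₗ F.defectFam a

lemma defectVec_apply (F : Chain n k E) (a : Fin (k + 1)) (f : Fock n (E a)) :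
    F.defectVec a f = F.mkSum (F.defectFam a f) := rfl

lemma norm_prod_sq_add (F : Chain n k E) (a b : Fin (k + 1)) (hab : a ≤ b) (f : Fock n (E a)) :
    ‖(F.prod a b hab).toCLM f‖ ^ 2 +
      ∑ i : Fin k with i.castSucc < b, ‖F.defectFam a f i‖ ^ 2 = ‖f‖ ^ 2 := by
  induction b using Fin.induction with
  | zero =>
    obtain rfl : a = 0 := le_antisymm hab (Fin.zero_le _)
    rw [prod_self]
    simp [Op.one]
  | succ i ih =>
    rcases hab.eq_or_lt with rfl | hlt
    · rw [prod_self, Finset.sum_eq_zero]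
      · simp [Op.one]
      · intro l hl
        rw [Finset.mem_filter] at hl
        rw [F.defectFam_of_not_le _ f l (not_le.2 hl.2)]
        simp
    · have h : a ≤ i.castSucc := Fin.le_castSucc_iff.2 hlt
      have hfil : (Finset.univ.filter fun l : Fin k => l.castSucc < i.succ) =
          insert i (Finset.univ.filter fun l : Fin k => l.castSucc < i.castSucc) := by
        ext l
        simp only [Finset.mem_filter, Finset.mem_univ, true_and, Finset.mem_insert,
          Fin.castSucc_lt_succ_iff, Fin.castSucc_lt_castSucc_iff]
        exact le_iff_eq_or_lt
      rw [hfil, Finset.sum_insert (by simp), ← ih h, prod_succ F a i h,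
        F.defectFam_of_le a f i h, norm_defectMap_sq _ (F i).norm_le_one]
      simp only [Op.comp, ContinuousLinearMap.comp_apply]
      ring

lemma norm_defectVec_sq (F : Chain n k E) (a : Fin (k + 1)) (f : Fock n (E a)) :
    ‖(F.prod a (Fin.last k) (Fin.le_last a)).toCLM f‖ ^ 2 + ‖F.defectVec a f‖ ^ 2 = ‖f‖ ^ 2 := by
  rw [← F.norm_prod_sq_add a (Fin.last k) (Fin.le_last a) f, defectVec_apply,
    HPi.norm_mk_sq]
  congr 2
  ext i
  simp [Fin.castSucc_lt_last]

/-- The isometry `Z_k` from the defect space of `Θ = Θ_k ⋯ Θ_1` to the sum of the defect spaces of the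
factors, the continuous extension of
`Z_k (Δ_Θ f) = Δ_k Θ_{k-1} ⋯ Θ_1 f ⊕ ⋯ ⊕ Δ_2 Θ_1 f ⊕ Δ_1 f`. -/
def Z (F : Chain n k E) : DefectSpace F.total.toCLM →L[ℂ] F.DefectSum :=
  (F.defectVec 0).extendOfNorm (defectMap F.total.toCLM)

lemma norm_defectVec_zero (F : Chain n k E) (f : Fock n (E 0)) :
    ‖F.defectVec 0 f‖ = ‖defectMap F.total.toCLM f‖ := by
  rw [← sq_eq_sq₀ (norm_nonneg _) (norm_nonneg _), norm_defectMap_sq _ F.total.norm_le_one,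
    ← F.norm_defectVec_sq 0 f, total]
  ring

lemma Z_defectMap (F : Chain n k E) (f : Fock n (E 0)) :
    F.Z (defectMap F.total.toCLM f) = F.defectVec 0 f :=
  LinearMap.extendOfNorm_eq (denseRange_defectMap _)
    ⟨1, fun x => by rw [norm_defectVec_zero, one_mul]⟩ f

lemma norm_Z (F : Chain n k E) (x : DefectSpace F.total.toCLM) : ‖F.Z x‖ = ‖x‖ := by
  refine (denseRange_defectMap F.total.toCLM).induction_on x
    (isClosed_eq F.Z.continuous.norm continuous_norm) fun f => ?_
  rw [Z_defectMap, norm_defectVec_zero]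

/-- The factorization `Θ = Θ_k ⋯ Θ_1` is `k`-regular: `Z_k` is unitary. -/
def IsRegular (F : Chain n k E) : Prop :=
  F.Z.adjoint ∘L F.Z = ContinuousLinearMap.id ℂ _ ∧ F.Z ∘L F.Z.adjoint = ContinuousLinearMap.id ℂ _

/-- The families `0 ⊕ ⋯ ⊕ 0 ⊕ g_a ⊕ ⋯ ⊕ g_1` with `g_1, …, g_a` in the defect spaces of
`Θ_1, …, Θ_a`. -/
def freeSpace (F : Chain n k E) (a : Fin (k + 1)) :
    Submodule ℂ (∀ i, DefectSpace (F i).toCLM) where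
  carrier := {g | ∀ i, a ≤ i.castSucc → g i = 0}
  zero_mem' := fun _ _ => rfl
  add_mem' := fun {g g'} hg hg' i hi => by rw [Pi.add_apply, hg i hi, hg' i hi, add_zero]
  smul_mem' := fun c g hg i hi => by rw [Pi.smul_apply, hg i hi, smul_zero]

/-- The map `(f, g) ↦ Θ_k ⋯ Θ_{a+1} f ⊕
Z_k* ((Δ_k Θ_{k-1} ⋯ Θ_{a+1} f ⊕ ⋯ ⊕ Δ_{a+1} f ⊕ 0 ⊕ ⋯ ⊕ 0) + g)`. -/
def bigMap (F : Chain n k E) (a : Fin (k + 1)) :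
    (Fock n (E a) × ∀ i, DefectSpace (F i).toCLM) →ₗ[ℂ] F.total.Ambient :=
  (HSum.mk (Fock n (E (Fin.last k))) (DefectSpace F.total.toCLM)).toLinearMap ∘ₗ
    ((F.prod a (Fin.last k) (Fin.le_last a)).toCLM.toLinearMap ∘ₗ LinearMap.fst ℂ _ _).prod
      (F.Z.adjoint.toLinearMap ∘ₗ F.mkSum.toLinearMap ∘ₗ
        (F.defectFam a ∘ₗ LinearMap.fst ℂ _ _ + LinearMap.snd ℂ _ _))

lemma bigMap_apply (F : Chain n k E) (a : Fin (k + 1)) (f : Fock n (E a))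
    (g : ∀ i, DefectSpace (F i).toCLM) :
    F.bigMap a (f, g) = HSum.mk (Fock n (E (Fin.last k))) (DefectSpace F.total.toCLM)
      ((F.prod a (Fin.last k) (Fin.le_last a)).toCLM f,
        F.Z.adjoint (F.mkSum (F.defectFam a f + g))) := rfl

/-- The subspace of all
`Θ_k ⋯ Θ_{a+1} f ⊕ Z_k* (Δ_k Θ_{k-1} ⋯ Θ_{a+1} f ⊕ ⋯ ⊕ Δ_{a+1} f ⊕ g_a ⊕ ⋯ ⊕ g_1)`
with `f ∈ Γ ⊗ E_{a+1}` and `g_1, …, g_a` in the defect spaces of `Θ_1, …, Θ_a`. -/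
def bigSpace (F : Chain n k E) (a : Fin (k + 1)) : Submodule ℂ F.total.Ambient :=
  (Submodule.prod ⊤ (F.freeSpace a)).map (F.bigMap a)

lemma norm_Z_adjoint (F : Chain n k E) (hF : F.IsRegular) (y : F.DefectSum) :
    ‖F.Z.adjoint y‖ = ‖y‖ := by
  rw [← F.norm_Z]
  exact congrArg norm (DFunLike.congr_fun hF.2 y)

lemma norm_bigMap_sq (F : Chain n k E) (hF : F.IsRegular) (a : Fin (k + 1)) (f : Fock n (E a))
    (g : ∀ i, DefectSpace (F i).toCLM) (hg : g ∈ F.freeSpace a) :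
    ‖F.bigMap a (f, g)‖ ^ 2 = ‖f‖ ^ 2 + ∑ i, ‖g i‖ ^ 2 := by
  have key : ∀ i, ‖(F.defectFam a f + g) i‖ ^ 2 = ‖F.defectFam a f i‖ ^ 2 + ‖g i‖ ^ 2 := by
    intro i
    rw [Pi.add_apply]
    by_cases h : a ≤ i.castSucc
    · rw [hg i h, add_zero, norm_zero]
      ring
    · rw [F.defectFam_of_not_le a f i h, zero_add, norm_zero]
      ring
  have h1 := F.norm_defectVec_sq a f
  rw [defectVec_apply, HPi.norm_mk_sq] at h1
  rw [bigMap_apply, HSum.norm_mk_sq, F.norm_Z_adjoint hF, HPi.norm_mk_sq,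
    Finset.sum_congr rfl fun i _ => key i, Finset.sum_add_distrib, ← h1]
  ring

lemma isClosed_freeSpace (F : Chain n k E) (a : Fin (k + 1)) :
    IsClosed ((F.freeSpace a).map F.mkSum.toLinearMap : Set F.DefectSum) := by
  have h : IsClosed (F.freeSpace a : Set (∀ i, DefectSpace (F i).toCLM)) := by
    have : (F.freeSpace a : Set (∀ i, DefectSpace (F i).toCLM)) =
        ⋂ i : Fin k, ⋂ _ : a ≤ i.castSucc, {g | g i = 0} := by
      ext g
      simp only [Set.mem_iInter]
      rfl
    rw [this]
    exact isClosed_iInter fun i => isClosed_iInter fun _ =>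
      isClosed_eq (continuous_apply i) continuous_const
  exact F.mkSum.toHomeomorph.isClosedMap _ h

lemma isClosed_bigSpace (F : Chain n k E) (hF : F.IsRegular) (a : Fin (k + 1)) :
    IsClosed (F.bigSpace a : Set F.total.Ambient) := by
  let V := (F.freeSpace a).map F.mkSum.toLinearMap
  have : CompleteSpace V := (F.isClosed_freeSpace a).completeSpace_coe
  let e := HSum.mk (Fock n (E a)) V
  let L₀ : HSum (Fock n (E a)) V →ₗ[ℂ] F.total.Ambient :=
    F.bigMap a ∘ₗ LinearMap.prodMap LinearMap.id (F.mkSum.symm.toLinearMap ∘ₗ V.subtype) ∘ₗ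
      e.symm.toContinuousLinearMap.toLinearMap
  have hL₀ : ∀ (f : Fock n (E a)) (g : ∀ i, DefectSpace (F i).toCLM) (hg : F.mkSum g ∈ V),
      L₀ (e (f, ⟨F.mkSum g, hg⟩)) = F.bigMap a (f, g) := fun f g hg => rfl
  have he : ∀ q, ∃ (f : Fock n (E a)) (g : ∀ i, DefectSpace (F i).toCLM) (_ : g ∈ F.freeSpace a)
      (hg : F.mkSum g ∈ V), q = e (f, ⟨F.mkSum g, hg⟩) := by
    intro q
    obtain ⟨⟨f, ⟨_, g, hg, rfl⟩⟩, rfl⟩ := e.surjective q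
    exact ⟨f, g, hg, ⟨g, hg, rfl⟩, rfl⟩
  let L : HSum (Fock n (E a)) V →ₗᵢ[ℂ] F.total.Ambient :=
    { toLinearMap := L₀
      norm_map' := fun q => by
        obtain ⟨f, g, hg, hgV, rfl⟩ := he q
        rw [← sq_eq_sq₀ (norm_nonneg _) (norm_nonneg _), hL₀, F.norm_bigMap_sq hF a f g hg,
          HSum.norm_mk_sq, Submodule.coe_norm, HPi.norm_mk_sq] }
  have hL : (F.bigSpace a : Set F.total.Ambient) = Set.range L := by
    ext x
    constructor
    · rintro ⟨⟨f, g⟩, ⟨_, hg⟩, rfl⟩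
      exact ⟨e (f, ⟨F.mkSum g, ⟨g, hg, rfl⟩⟩), hL₀ _ _ _⟩
    · rintro ⟨q, rfl⟩
      obtain ⟨f, g, hg, hgV, rfl⟩ := he q
      exact ⟨(f, g), ⟨trivial, hg⟩, (hL₀ _ _ _).symm⟩
  rw [hL]
  exact L.isometry.isClosedEmbedding.isClosed_range

end Chain

/-! ### The chain of invariant subspaces of a regular factorization -/

/-- A `k`-regular factorization `Θ = Θ_k ⋯ Θ_1` into contractive multi-analytic operators. -/
structure RegularFactorization (n k : ℕ) (E : Fin (k + 1) → Type u)
    [∀ i, NormedAddCommGroup (E i)] [∀ i, InnerProductSpace ℂ (E i)]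
    [∀ i, CompleteSpace (E i)] where
  factor : Chain n k E
  regular : factor.IsRegular

namespace RegularFactorization

variable [∀ i, CompleteSpace (E i)]

/-- The product `Θ = Θ_k ⋯ Θ_1`. -/
abbrev Theta (R : RegularFactorization n k E) : Op n (E 0) (E (Fin.last k)) := R.factor.total

/-- The subspace `M_a = bigSpace a ⊖ G_Θ` of `H(Θ)`, that is, `bigSpace a ∩ H(Θ)`. -/
def invSpace (R : RegularFactorization n k E) (a : Fin (k + 1)) :
    Submodule ℂ R.Theta.modelSpace :=
  (R.factor.bigSpace a).comap R.Theta.modelSpace.subtype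

/-- The chain `0 ⊆ M_1 ⊆ ⋯ ⊆ M_{k-1} ⊆ H(Θ)`, completed by `0` and `H(Θ)` at its ends. -/
def flag (R : RegularFactorization n k E) (a : Fin (k + 1)) : Submodule ℂ R.Theta.modelSpace :=
  if a = 0 then ⊥ else if a = Fin.last k then ⊤ else R.invSpace a

/-- The difference spaces, in the shifted numbering: `block 0 = M_1`, `block i = M_{i+1} ⊖ M_i` for
`0 < i < k - 1`, and `block (k-1) = H(Θ) ⊖ M_{k-1}`. -/
def block (R : RegularFactorization n k E) (i : Fin k) : Submodule ℂ R.Theta.modelSpace :=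
  R.flag i.succ ⊓ (R.flag i.castSucc)ᗮ

lemma isClosed_flag (R : RegularFactorization n k E) (a : Fin (k + 1)) :
    IsClosed (R.flag a : Set R.Theta.modelSpace) := by
  unfold flag
  split_ifs
  · simp
  · simp
  · exact (R.factor.isClosed_bigSpace R.regular a).preimage continuous_subtype_val

instance (R : RegularFactorization n k E) (i : Fin k) : CompleteSpace (R.block i) :=
  ((R.isClosed_flag i.succ).inter
    (Submodule.isClosed_orthogonal (R.flag i.castSucc))).completeSpace_coe

/-- The entry `P_{H_i} T_{Θ,j} | H_l` in row `i` and column `l` of the block matrix of `T_{Θ,j}`. -/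
def entry (R : RegularFactorization n k E) (j : Fin n) (i l : Fin k) :
    R.block l →L[ℂ] R.block i :=
  (R.block i).orthogonalProjectionOnto ∘L R.Theta.model j ∘L (R.block l).subtypeL

/-- The tuple `A^i = [A^i_1, …, A^i_n]` of the diagonal blocks `A^i_j = P_{H_i} T_{Θ,j} | H_i`. -/
def diag (R : RegularFactorization n k E) (i : Fin k) (j : Fin n) : R.block i →L[ℂ] R.block i :=
  R.entry j i i

end RegularFactorization

end Chain

end MultiAnalytic

end

/-!
The operator `T_{Θ,j}` is the compression to `H(Θ)` of the isometry `V_j = (S_j ⊗ I) ⊕ C_j` of the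
ambient space (`ambientShift`, `inner_model`), and `V_1, …, V_n` have pairwise orthogonal ranges, so
Bessel's inequality makes `T_Θ` a row contraction.

Let `B_a` be the subspace `bigSpace a`. The map `Z_k` carries `C_j` to the direct sum of the row
isometries of the factors (`Z_rowIsometry`). As `Z_k` is unitary, this gives `V_j B_a ⊆ B_a`
(`ambientShift_bigMap`), and also `B_0 = G_Θ` and `B_k` the whole ambient space, with
`B_a ⊆ B_{a+1}`. Hence `M_a = B_a ∩ H(Θ)` for all `a`, the ends included. For `x ∈ H(Θ)` the vectors
`T_{Θ,j} x` and `V_j x` differ by an element of the closed subspace `G_Θ ⊆ B_a`, so every `M_a` is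
invariant. The orthogonal decomposition and the triangular form hold for any such flag.

For the diagonal blocks, `M_{i+1} ⊖ M_i = B_{i+1} ⊖ B_i` (`mem_block_iff`). The isometry
`factorMap i` embeds the ambient space of the factor `R.factor i` into that of `Θ` and intertwines the
two isometric dilations. With a subspace `N` orthogonal to its range (`tailSpace`), `B_{i+1}` is the
range plus `N`, and `B_i` is the image of the graph of the factor plus `N`. So `factorMap i`
restricts to a unitary from the model space of the factor onto `B_{i+1} ⊖ B_i` (`factorEquiv`), and
compressing the dilations to these two spaces gives the equivalence.

The indices here are those of the definitions, which start the numbering of the factors at `0`.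
-/

open scoped InnerProductSpace

noncomputable section

namespace MultiAnalytic

/-! ### Row contractions and flags in Hilbert spaces -/

section Hilbert

variable {n : ℕ} {H : Type*} [NormedAddCommGroup H] [InnerProductSpace ℂ H]

lemma isRowContraction_of_sum_norm_sq_le [CompleteSpace H] (T : Fin n → H →L[ℂ] H)
    (hT : ∀ x, ∑ j, ‖(T j).adjoint x‖ ^ 2 ≤ ‖x‖ ^ 2) : IsRowContraction T := by
  rw [IsRowContraction, ContinuousLinearMap.le_def, ContinuousLinearMap.isPositive_iff_complex]
  intro x
  have h : ⟪(1 - ∑ j, T j ∘L (T j).adjoint) x, x⟫_ℂ =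
      ((‖x‖ ^ 2 - ∑ j, ‖(T j).adjoint x‖ ^ 2 : ℝ) : ℂ) := by
    rw [sub_apply, inner_sub_left, sum_apply, sum_inner]
    push_cast
    congr 1
    · exact inner_self_eq_norm_sq_to_K x
    · refine Finset.sum_congr rfl fun j _ => ?_
      rw [Function.comp_apply, ← ContinuousLinearMap.adjoint_inner_right]
      exact inner_self_eq_norm_sq_to_K _
  rw [h]
  exact ⟨by rw [RCLike.re_to_complex, Complex.ofReal_re],
    by rw [RCLike.re_to_complex, Complex.ofReal_re]; linarith [hT x]⟩

/-- Bessel's inequality for isometries with pairwise orthogonal ranges. -/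
lemma sum_norm_adjoint_sq_le [CompleteSpace H] (V : Fin n → H →L[ℂ] H)
    (hV : ∀ i j x y, ⟪V i x, V j y⟫_ℂ = if i = j then ⟪x, y⟫_ℂ else 0) (x : H) :
    ∑ j, ‖(V j).adjoint x‖ ^ 2 ≤ ‖x‖ ^ 2 := by
  -- `y` is the projection of `x` onto the sum of the ranges
  set y : H := ∑ j, V j ((V j).adjoint x) with hy
  have hxy : ⟪x, y⟫_ℂ = ((∑ j, ‖(V j).adjoint x‖ ^ 2 : ℝ) : ℂ) := by
    rw [hy, inner_sum]
    push_cast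
    refine Finset.sum_congr rfl fun j _ => ?_
    rw [← ContinuousLinearMap.adjoint_inner_left]
    exact inner_self_eq_norm_sq_to_K _
  have hyy : ⟪y, y⟫_ℂ = ((∑ j, ‖(V j).adjoint x‖ ^ 2 : ℝ) : ℂ) := by
    rw [hy, sum_inner]
    push_cast
    refine Finset.sum_congr rfl fun j _ => ?_
    rw [inner_sum]
    simp only [hV, Finset.sum_ite_eq, Finset.mem_univ, if_true]
    exact inner_self_eq_norm_sq_to_K _
  have h1 := norm_sub_sq (𝕜 := ℂ) x y
  have h2 : ‖y‖ ^ 2 = ∑ j, ‖(V j).adjoint x‖ ^ 2 := by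
    have := inner_self_eq_norm_sq_to_K (𝕜 := ℂ) y
    rw [hyy] at this
    exact (Complex.ofReal_injective (by rw [this]; push_cast; rfl)).symm
  rw [hxy, h2, RCLike.re_to_complex, Complex.ofReal_re] at h1
  nlinarith [sq_nonneg ‖x - y‖]

lemma compression_eq_zero {K L : Submodule ℂ H} [K.HasOrthogonalProjection] (T : H →L[ℂ] H)
    (h : ∀ x ∈ L, T x ∈ Kᗮ) : K.orthogonalProjectionOnto ∘L T ∘L L.subtypeL = 0 := by
  ext1 x
  have : K.orthogonalProjectionOnto (T x) = 0 :=
    Submodule.orthogonalProjectionOnto_apply_of_mem_orthogonal (h x x.2)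
  exact this

lemma inner_compression (K : Submodule ℂ H) [K.HasOrthogonalProjection] (T : H →L[ℂ] H) (x y : K) :
    ⟪(K.orthogonalProjectionOnto ∘L T ∘L K.subtypeL) x, y⟫_ℂ = ⟪T x, (y : H)⟫_ℂ :=
  Submodule.inner_orthogonalProjectionOnto_eq_of_mem_right y (T x)

lemma isRowContraction_compression [CompleteSpace H] (K : Submodule ℂ H) [CompleteSpace K]
    (T : Fin n → H →L[ℂ] H) (hT : ∀ x, ∑ j, ‖(T j).adjoint x‖ ^ 2 ≤ ‖x‖ ^ 2) :
    IsRowContraction (H := K) fun j => K.orthogonalProjectionOnto ∘L T j ∘L K.subtypeL := by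
  have hj : ∀ j, (K.orthogonalProjectionOnto ∘L T j ∘L K.subtypeL).adjoint =
      K.orthogonalProjectionOnto ∘L (T j).adjoint ∘L K.subtypeL := fun j => by
    rw [ContinuousLinearMap.adjoint_comp, ContinuousLinearMap.adjoint_comp,
      Submodule.adjoint_subtypeL, Submodule.adjoint_orthogonalProjectionOnto]
    rfl
  refine isRowContraction_of_sum_norm_sq_le _ fun x => ?_
  have h : ∀ j, ‖(K.orthogonalProjectionOnto ∘L T j ∘L K.subtypeL).adjoint x‖ ≤
      ‖(T j).adjoint (x : H)‖ := fun j => by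
    rw [hj]
    exact Submodule.norm_orthogonalProjectionOnto_apply_le K ((T j).adjoint (x : H))
  calc ∑ j, ‖(K.orthogonalProjectionOnto ∘L T j ∘L K.subtypeL).adjoint x‖ ^ 2
      ≤ ∑ j, ‖(T j).adjoint (x : H)‖ ^ 2 :=
        Finset.sum_le_sum fun j _ => pow_le_pow_left₀ (norm_nonneg _) (h j) 2
    _ ≤ ‖(x : H)‖ ^ 2 := hT (x : H)

variable {k : ℕ}

lemma orthogonalFamily_of_flag (M : Fin (k + 1) → Submodule ℂ H) (hM : Monotone M) :
    OrthogonalFamily ℂ (fun i : Fin k => (M i.succ ⊓ (M i.castSucc)ᗮ : Submodule ℂ H))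
      (fun i => (M i.succ ⊓ (M i.castSucc)ᗮ).subtypeₗᵢ) := by
  have key : ∀ i l : Fin k, i < l →
      (M i.succ ⊓ (M i.castSucc)ᗮ) ⟂ (M l.succ ⊓ (M l.castSucc)ᗮ) := by
    intro i l hil
    refine Submodule.isOrtho_iff_inner_eq.2 fun u hu v hv => ?_
    exact (Submodule.mem_orthogonal _ _).1 hv.2 u (hM (Fin.succ_le_castSucc_iff.2 hil) hu.1)
  refine OrthogonalFamily.of_pairwise fun i l hil => ?_
  rcases lt_or_gt_of_ne hil with h | h
  · exact key i l h
  · exact (key l i h).symm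

lemma isInternal_of_flag [CompleteSpace H] (M : Fin (k + 1) → Submodule ℂ H) (hM : Monotone M)
    (hc : ∀ a, IsClosed (M a : Set H)) (h0 : M 0 = ⊥) (h1 : M (Fin.last k) = ⊤) :
    DirectSum.IsInternal fun i : Fin k => M i.succ ⊓ (M i.castSucc)ᗮ := by
  refine DirectSum.isInternal_submodule_of_iSupIndep_of_iSup_eq_top
    (orthogonalFamily_of_flag M hM).independent (top_le_iff.1 ?_)
  rw [← h1]
  have h : ∀ a, M a ≤ ⨆ i : Fin k, M i.succ ⊓ (M i.castSucc)ᗮ := by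
    intro a
    induction a using Fin.induction with
    | zero => rw [h0]; exact bot_le
    | succ i ih =>
      have : CompleteSpace (M i.castSucc) := (hc i.castSucc).completeSpace_coe
      rw [← Submodule.sup_orthogonal_inf_of_hasOrthogonalProjection
        (hM (Fin.castSucc_le_succ i)), inf_comm]
      exact sup_le ih (le_iSup (fun i : Fin k => M i.succ ⊓ (M i.castSucc)ᗮ) i)
  exact h _

end Hilbert

/-! ### The isometric dilation of the model operators -/

lemma inner_creation {n : ℕ} {E : Type*} [NormedAddCommGroup E] [InnerProductSpace ℂ E]
    (i j : Fin n) (f g : Fock n E) :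
    ⟪creation E i f, creation E j g⟫_ℂ = if i = j then ⟪f, g⟫_ℂ else 0 := by
  split_ifs with h
  · rw [h, LinearIsometry.inner_map_map]
  · refine (lp.inner_eq_tsum (𝕜 := ℂ) (G := fun _ : List (Fin n) => E) _ _).trans ?_
    refine (tsum_congr fun α => ?_).trans tsum_zero
    change ⟪shift i f.coeff α, shift j g.coeff α⟫_ℂ = 0
    cases α with
    | nil => exact inner_zero_left _
    | cons l β =>
      by_cases hl : l = i
      · have : l ≠ j := fun h' => h (hl.symm.trans h')
        simp [shift, this]
      · simp [shift, hl]

lemma inner_defectMap {H K : Type*} [NormedAddCommGroup H] [InnerProductSpace ℂ H]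
    [CompleteSpace H] [NormedAddCommGroup K] [InnerProductSpace ℂ K] [CompleteSpace K]
    (A : H →L[ℂ] K) (hA : ‖A‖ ≤ 1) (x y : H) :
    ⟪defectMap A x, defectMap A y⟫_ℂ = ⟪x, y⟫_ℂ - ⟪A x, A y⟫_ℂ := by
  -- the map `x ↦ A x ⊕ Δ_A x` is isometric
  let L : H →ₗᵢ[ℂ] HSum K (DefectSpace A) :=
    { toLinearMap := (HSum.mk K (DefectSpace A)).toLinearMap ∘ₗ A.toLinearMap.prod (defectMap A)
      norm_map' := fun z => by
        rw [← sq_eq_sq₀ (norm_nonneg _) (norm_nonneg _)]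
        refine (HSum.norm_mk_sq (A z, defectMap A z)).trans ?_
        rw [norm_defectMap_sq A hA]
        ring }
  have h : ⟪A x, A y⟫_ℂ + ⟪defectMap A x, defectMap A y⟫_ℂ = ⟪x, y⟫_ℂ := L.inner_map_map x y
  rw [← h]
  ring

namespace Op

variable {n : ℕ} {E F : Type*}
  [NormedAddCommGroup E] [InnerProductSpace ℂ E] [CompleteSpace E]
  [NormedAddCommGroup F] [InnerProductSpace ℂ F] [CompleteSpace F]

lemma inner_rowIsometry (Θ : Op n E F) (i j : Fin n) (x y : DefectSpace Θ.toCLM) :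
    ⟪Θ.rowIsometry i x, Θ.rowIsometry j y⟫_ℂ = if i = j then ⟪x, y⟫_ℂ else 0 := by
  refine (denseRange_defectMap Θ.toCLM).induction_on₂
    (p := fun x y => ⟪Θ.rowIsometry i x, Θ.rowIsometry j y⟫_ℂ = if i = j then ⟪x, y⟫_ℂ else 0)
    ?_ (fun f g => ?_) x y
  · refine isClosed_eq (by fun_prop) ?_
    split_ifs <;> fun_prop
  · rw [rowIsometry_defectMap, rowIsometry_defectMap, inner_defectMap _ Θ.norm_le_one,
      inner_defectMap _ Θ.norm_le_one, Θ.intertwines, Θ.intertwines, inner_creation,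
      inner_creation]
    split_ifs <;> simp

/-- The isometry `f ⊕ g ↦ (S_j ⊗ I) f ⊕ C_j g` of the ambient space, of which `T_{Θ,j}` is the
compression to `H(Θ)`. -/
def ambientShift (Θ : Op n E F) (j : Fin n) : Θ.Ambient →L[ℂ] Θ.Ambient :=
  (HSum.mk (Fock n F) (DefectSpace Θ.toCLM)).toContinuousLinearMap
    ∘L ((creation F j).toContinuousLinearMap.prodMap (Θ.rowIsometry j))
    ∘L (HSum.mk (Fock n F) (DefectSpace Θ.toCLM)).symm.toContinuousLinearMap

lemma ambientShift_mk (Θ : Op n E F) (j : Fin n) (f : Fock n F) (g : DefectSpace Θ.toCLM) :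
    Θ.ambientShift j (HSum.mk _ _ (f, g)) = HSum.mk _ _ (creation F j f, Θ.rowIsometry j g) :=
  rfl

lemma adjoint_ambientShift (Θ : Op n E F) (j : Fin n) :
    (Θ.ambientShift j).adjoint = Θ.ambientAdjoint j := by
  symm
  rw [ContinuousLinearMap.eq_adjoint_iff]
  intro x y
  obtain ⟨p, rfl⟩ := (HSum.mk (Fock n F) (DefectSpace Θ.toCLM)).surjective x
  obtain ⟨q, rfl⟩ := (HSum.mk (Fock n F) (DefectSpace Θ.toCLM)).surjective y
  change ⟪(creation F j).toContinuousLinearMap.adjoint p.1, q.1⟫_ℂ +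
    ⟪(Θ.rowIsometry j).adjoint p.2, q.2⟫_ℂ =
      ⟪p.1, creation F j q.1⟫_ℂ + ⟪p.2, Θ.rowIsometry j q.2⟫_ℂ
  rw [ContinuousLinearMap.adjoint_inner_left, ContinuousLinearMap.adjoint_inner_left]
  rfl

lemma inner_ambientShift (Θ : Op n E F) (i j : Fin n) (x y : Θ.Ambient) :
    ⟪Θ.ambientShift i x, Θ.ambientShift j y⟫_ℂ = if i = j then ⟪x, y⟫_ℂ else 0 := by
  obtain ⟨p, rfl⟩ := (HSum.mk (Fock n F) (DefectSpace Θ.toCLM)).surjective x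
  obtain ⟨q, rfl⟩ := (HSum.mk (Fock n F) (DefectSpace Θ.toCLM)).surjective y
  change ⟪creation F i p.1, creation F j q.1⟫_ℂ +
    ⟪Θ.rowIsometry i p.2, Θ.rowIsometry j q.2⟫_ℂ =
      if i = j then ⟪p.1, q.1⟫_ℂ + ⟪p.2, q.2⟫_ℂ else 0
  rw [inner_creation, inner_rowIsometry]
  split_ifs <;> simp

lemma sum_norm_adjoint_model_sq_le (Θ : Op n E F) (x : Θ.modelSpace) :
    ∑ j, ‖(Θ.model j).adjoint x‖ ^ 2 ≤ ‖x‖ ^ 2 := by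
  simp only [model, ContinuousLinearMap.adjoint_adjoint]
  have h := sum_norm_adjoint_sq_le Θ.ambientShift Θ.inner_ambientShift (x : Θ.Ambient)
  simp only [adjoint_ambientShift] at h
  exact h

lemma isRowContraction_model (Θ : Op n E F) :
    IsRowContraction (H := Θ.modelSpace) Θ.model :=
  isRowContraction_of_sum_norm_sq_le _ Θ.sum_norm_adjoint_model_sq_le

/-- `T_{Θ,j}` is the compression of `ambientShift j` to `H(Θ)`. -/
lemma inner_model (Θ : Op n E F) (j : Fin n) (x y : Θ.modelSpace) :
    ⟪Θ.model j x, y⟫_ℂ = ⟪Θ.ambientShift j x, (y : Θ.Ambient)⟫_ℂ := by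
  rw [model, ContinuousLinearMap.adjoint_inner_left, ← ContinuousLinearMap.adjoint_inner_right,
    adjoint_ambientShift]
  rfl

/-- `T_{Θ,j}` and its isometric dilation differ by vectors orthogonal to `H(Θ)`. -/
lemma model_sub_ambientShift_mem (Θ : Op n E F) (j : Fin n) (x : Θ.modelSpace) :
    (Θ.model j x : Θ.Ambient) - Θ.ambientShift j x ∈ Θ.modelSpaceᗮ := by
  rw [Submodule.mem_orthogonal']
  intro y hy
  rw [inner_sub_left, sub_eq_zero]
  exact Θ.inner_model j x ⟨y, hy⟩

end Op

section Chain

universe u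

variable {n k : ℕ} {E : Fin (k + 1) → Type u} [∀ i, NormedAddCommGroup (E i)]
  [∀ i, InnerProductSpace ℂ (E i)]

namespace Chain

/-! ### Shifts on the spaces of a factorization -/

/-- A product that starts at `i.castSucc` splits off its first factor `F i`. -/
lemma prod_castSucc_apply (F : Chain n k E) (i : Fin k) (b : Fin (k + 1)) (h : i.succ ≤ b)
    (f : Fock n (E i.castSucc)) :
    (F.prod i.castSucc b ((Fin.castSucc_le_succ i).trans h)).toCLM f =
      (F.prod i.succ b h).toCLM ((F i).toCLM f) := by
  induction b using Fin.induction with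
  | zero => exact absurd h (not_le.2 (Fin.succ_pos i))
  | succ l ih =>
    rcases h.eq_or_lt with h' | h'
    · obtain rfl := Fin.succ_injective _ h'
      rw [prod_succ F _ _ le_rfl, prod_self, prod_self]
      rfl
    · have hl : i.succ ≤ l.castSucc := Fin.le_castSucc_iff.2 h'
      rw [prod_succ F _ _ hl, prod_succ F _ _ ((Fin.castSucc_le_succ i).trans hl)]
      exact congrArg (F l).toCLM (ih hl)

variable [∀ i, CompleteSpace (E i)]

lemma defectFam_castSucc (F : Chain n k E) (i : Fin k) (f : Fock n (E i.castSucc)) :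
    F.defectFam i.castSucc f =
      F.defectFam i.succ ((F i).toCLM f) + Pi.single i (defectMap (F i).toCLM f) := by
  funext l
  rw [Pi.add_apply]
  rcases lt_trichotomy l i with h | rfl | h
  · rw [F.defectFam_of_not_le _ _ _ (not_le.2 (Fin.castSucc_lt_castSucc_iff.2 h)),
      F.defectFam_of_not_le _ _ _
        (not_le.2 ((Fin.castSucc_lt_castSucc_iff.2 h).trans Fin.castSucc_lt_succ)),
      Pi.single_eq_of_ne h.ne, add_zero]
  · rw [F.defectFam_of_le _ _ _ le_rfl, prod_self,
      F.defectFam_of_not_le _ _ _ (not_le.2 Fin.castSucc_lt_succ), Pi.single_eq_same, zero_add]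
    rfl
  · have hl : i.succ ≤ l.castSucc := Fin.succ_le_castSucc_iff.2 h
    rw [F.defectFam_of_le _ _ _ hl, F.defectFam_of_le _ _ _ ((Fin.castSucc_le_succ i).trans hl),
      prod_castSucc_apply F i _ hl, Pi.single_eq_of_ne h.ne', add_zero]

lemma bigMap_castSucc (F : Chain n k E) (i : Fin k) (f : Fock n (E i.castSucc))
    (g : ∀ i, DefectSpace (F i).toCLM) :
    F.bigMap i.castSucc (f, g) =
      F.bigMap i.succ ((F i).toCLM f, Pi.single i (defectMap (F i).toCLM f) + g) := by
  rw [bigMap_apply, bigMap_apply, defectFam_castSucc, prod_castSucc_apply F i _ (Fin.le_last _),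
    add_assoc]

lemma bigMap_zero_left (F : Chain n k E) (a b : Fin (k + 1)) (g : ∀ i, DefectSpace (F i).toCLM) :
    F.bigMap a (0, g) = F.bigMap b (0, g) := by
  rw [bigMap_apply, bigMap_apply, map_zero, map_zero, map_zero, map_zero]

/-- The row isometry of the sum of the defect spaces, acting in each of them by `C_j`. -/
def sumShift (F : Chain n k E) (j : Fin n) :
    (∀ i, DefectSpace (F i).toCLM) →L[ℂ] ∀ i, DefectSpace (F i).toCLM :=
  ContinuousLinearMap.pi fun i => (F i).rowIsometry j ∘L ContinuousLinearMap.proj i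

lemma sumShift_apply (F : Chain n k E) (j : Fin n) (g : ∀ i, DefectSpace (F i).toCLM)
    (i : Fin k) : F.sumShift j g i = (F i).rowIsometry j (g i) := rfl

lemma sumShift_mem_freeSpace (F : Chain n k E) (j : Fin n) {a : Fin (k + 1)}
    {g : ∀ i, DefectSpace (F i).toCLM} (hg : g ∈ F.freeSpace a) :
    F.sumShift j g ∈ F.freeSpace a := fun i hi => by
  rw [sumShift_apply, hg i hi, map_zero]

lemma sumShift_single (F : Chain n k E) (j : Fin n) (i : Fin k) (d : DefectSpace (F i).toCLM) :
    F.sumShift j (Pi.single i d) = Pi.single i ((F i).rowIsometry j d) := by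
  funext l
  rw [sumShift_apply]
  rcases eq_or_ne l i with rfl | h
  · rw [Pi.single_eq_same, Pi.single_eq_same]
  · rw [Pi.single_eq_of_ne h, Pi.single_eq_of_ne h, map_zero]

lemma defectFam_creation (F : Chain n k E) (a : Fin (k + 1)) (j : Fin n) (f : Fock n (E a)) :
    F.defectFam a (creation _ j f) = F.sumShift j (F.defectFam a f) := by
  funext i
  rw [sumShift_apply]
  by_cases h : a ≤ i.castSucc
  · rw [F.defectFam_of_le _ _ _ h, F.defectFam_of_le _ _ _ h, Op.rowIsometry_defectMap,
      Op.intertwines]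
  · rw [F.defectFam_of_not_le _ _ _ h, F.defectFam_of_not_le _ _ _ h, map_zero]

lemma Z_rowIsometry (F : Chain n k E) (j : Fin n) (x : DefectSpace F.total.toCLM) :
    F.Z (F.total.rowIsometry j x) = F.mkSum (F.sumShift j (F.mkSum.symm (F.Z x))) := by
  refine (denseRange_defectMap F.total.toCLM).induction_on x
    (isClosed_eq (F.Z.continuous.comp (F.total.rowIsometry j).continuous)
      (F.mkSum.continuous.comp ((F.sumShift j).continuous.comp
        (F.mkSum.symm.continuous.comp F.Z.continuous)))) fun f => ?_
  rw [Op.rowIsometry_defectMap, Z_defectMap, Z_defectMap, defectVec_apply, defectVec_apply,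
    defectFam_creation, ContinuousLinearEquiv.symm_apply_apply]

lemma Z_adjoint_Z (F : Chain n k E) (hF : F.IsRegular) (x : DefectSpace F.total.toCLM) :
    F.Z.adjoint (F.Z x) = x := DFunLike.congr_fun hF.1 x

lemma Z_Z_adjoint (F : Chain n k E) (hF : F.IsRegular) (y : F.DefectSum) :
    F.Z (F.Z.adjoint y) = y := DFunLike.congr_fun hF.2 y

lemma rowIsometry_Z_adjoint (F : Chain n k E) (hF : F.IsRegular) (j : Fin n)
    (g : ∀ i, DefectSpace (F i).toCLM) :
    F.total.rowIsometry j (F.Z.adjoint (F.mkSum g)) = F.Z.adjoint (F.mkSum (F.sumShift j g)) := by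
  rw [← F.Z_adjoint_Z hF (F.total.rowIsometry j _), Z_rowIsometry, F.Z_Z_adjoint hF,
    ContinuousLinearEquiv.symm_apply_apply]

lemma ambientShift_bigMap (F : Chain n k E) (hF : F.IsRegular) (a : Fin (k + 1)) (j : Fin n)
    (f : Fock n (E a)) (g : ∀ i, DefectSpace (F i).toCLM) :
    F.total.ambientShift j (F.bigMap a (f, g)) =
      F.bigMap a (creation _ j f, F.sumShift j g) := by
  rw [bigMap_apply, bigMap_apply, Op.ambientShift_mk, F.rowIsometry_Z_adjoint hF,
    defectFam_creation, Op.intertwines, map_add]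

/-! ### The increasing chain of dilation-invariant subspaces -/

lemma ambientShift_mem_bigSpace (F : Chain n k E) (hF : F.IsRegular) (a : Fin (k + 1)) (j : Fin n)
    {x : F.total.Ambient} (hx : x ∈ F.bigSpace a) : F.total.ambientShift j x ∈ F.bigSpace a := by
  obtain ⟨⟨f, g⟩, ⟨_, hg⟩, rfl⟩ := hx
  rw [F.ambientShift_bigMap hF]
  exact ⟨(_, _), ⟨trivial, F.sumShift_mem_freeSpace j hg⟩, rfl⟩

lemma monotone_freeSpace (F : Chain n k E) : Monotone F.freeSpace :=
  fun _ _ hab _ hg i hi => hg i (hab.trans hi)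

lemma single_mem_freeSpace (F : Chain n k E) (i : Fin k) (d : DefectSpace (F i).toCLM) :
    Pi.single i d ∈ F.freeSpace i.succ := by
  intro l hl
  rw [Pi.single_eq_of_ne (Fin.succ_le_castSucc_iff.1 hl).ne']

lemma monotone_bigSpace (F : Chain n k E) : Monotone F.bigSpace := by
  refine Fin.monotone_iff_le_succ.2 fun i => ?_
  rintro _ ⟨⟨f, g⟩, ⟨_, hg⟩, rfl⟩
  rw [bigMap_castSucc]
  exact ⟨(_, _), ⟨trivial, add_mem (F.single_mem_freeSpace i _)
    (F.monotone_freeSpace (Fin.castSucc_le_succ i) hg)⟩, rfl⟩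

lemma bigSpace_zero (F : Chain n k E) (hF : F.IsRegular) : F.bigSpace 0 = F.total.graph := by
  have h : ∀ f, F.bigMap 0 (f, 0) = F.total.graphMap f := fun f => by
    rw [bigMap_apply, add_zero, ← defectVec_apply, ← Z_defectMap, F.Z_adjoint_Z hF]
    rfl
  ext x
  constructor
  · rintro ⟨⟨f, g⟩, ⟨_, hg⟩, rfl⟩
    obtain rfl : g = 0 := funext fun i => hg i (Fin.zero_le _)
    exact ⟨f, (h f).symm⟩
  · rintro ⟨f, rfl⟩
    exact ⟨(f, 0), ⟨trivial, (F.freeSpace 0).zero_mem⟩, h f⟩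

lemma bigSpace_last (F : Chain n k E) (hF : F.IsRegular) : F.bigSpace (Fin.last k) = ⊤ := by
  refine top_le_iff.1 fun x _ => ?_
  obtain ⟨⟨f, d⟩, rfl⟩ :=
    (HSum.mk (Fock n (E (Fin.last k))) (DefectSpace F.total.toCLM)).surjective x
  refine ⟨(f, F.mkSum.symm (F.Z d)),
    ⟨trivial, fun i hi => absurd hi (not_le.2 (Fin.castSucc_lt_last i))⟩, ?_⟩
  have h : F.defectFam (Fin.last k) f = 0 :=
    funext fun i => F.defectFam_of_not_le _ _ _ (not_le.2 (Fin.castSucc_lt_last i))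
  rw [bigMap_apply, h, zero_add, ContinuousLinearEquiv.apply_symm_apply, F.Z_adjoint_Z hF,
    prod_self]
  rfl

lemma graph_le_bigSpace (F : Chain n k E) (hF : F.IsRegular) (a : Fin (k + 1)) :
    F.total.graph ≤ F.bigSpace a := by
  rw [← F.bigSpace_zero hF]
  exact F.monotone_bigSpace (Fin.zero_le a)

lemma modelSpace_orthogonal_le_bigSpace (F : Chain n k E) (hF : F.IsRegular) (a : Fin (k + 1)) :
    F.total.modelSpaceᗮ ≤ F.bigSpace a := by
  rw [Op.modelSpace, Submodule.orthogonal_orthogonal_eq_closure]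
  exact Submodule.topologicalClosure_minimal _ (F.graph_le_bigSpace hF a)
    (F.isClosed_bigSpace hF a)

end Chain

namespace RegularFactorization

variable [∀ i, CompleteSpace (E i)]

/-! ### The flag of invariant subspaces and its difference spaces -/

/-- The two end members of the flag obey the same formula as the others. -/
lemma mem_flag_iff (R : RegularFactorization n k E) (a : Fin (k + 1)) (x : R.Theta.modelSpace) :
    x ∈ R.flag a ↔ (x : R.Theta.Ambient) ∈ R.factor.bigSpace a := by
  unfold flag
  split_ifs with h0 h1
  · subst h0
    rw [R.factor.bigSpace_zero R.regular, Submodule.mem_bot]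
    refine ⟨fun h => by rw [h]; exact Submodule.zero_mem _, fun h => ?_⟩
    exact Subtype.ext (inner_self_eq_zero.1 ((Submodule.mem_orthogonal _ _).1 x.2 _ h))
  · subst h1
    rw [R.factor.bigSpace_last R.regular]
    exact ⟨fun _ => trivial, fun _ => trivial⟩
  · rfl

lemma monotone_flag (R : RegularFactorization n k E) : Monotone R.flag := fun a b hab x hx => by
  rw [mem_flag_iff] at hx ⊢
  exact R.factor.monotone_bigSpace hab hx

lemma flag_zero (R : RegularFactorization n k E) : R.flag 0 = ⊥ := if_pos rfl

lemma flag_last (R : RegularFactorization n k E) : R.flag (Fin.last k) = ⊤ := by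
  refine top_le_iff.1 fun x _ => ?_
  rw [mem_flag_iff, R.factor.bigSpace_last R.regular]
  trivial

lemma model_mem_flag (R : RegularFactorization n k E) (a : Fin (k + 1)) (j : Fin n)
    {x : R.Theta.modelSpace} (hx : x ∈ R.flag a) : R.Theta.model j x ∈ R.flag a := by
  rw [mem_flag_iff] at hx ⊢
  have h1 := R.factor.modelSpace_orthogonal_le_bigSpace R.regular a
    (R.Theta.model_sub_ambientShift_mem j x)
  have h2 := R.factor.ambientShift_mem_bigSpace R.regular a j hx
  have h := (R.factor.bigSpace a).add_mem h1 h2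
  rwa [sub_add_cancel] at h

/-- Inside the ambient space the difference spaces are `bigSpace i.succ ⊖ bigSpace i.castSucc`:
subtracting `G_Θ` from both terms does not change the difference. -/
lemma mem_block_iff (R : RegularFactorization n k E) (i : Fin k) (x : R.Theta.modelSpace) :
    x ∈ R.block i ↔ (x : R.Theta.Ambient) ∈ R.factor.bigSpace i.succ ∧
      (x : R.Theta.Ambient) ∈ (R.factor.bigSpace i.castSucc)ᗮ := by
  rw [block, Submodule.mem_inf, mem_flag_iff, Submodule.mem_orthogonal, Submodule.mem_orthogonal]
  refine and_congr_right fun _ => ⟨fun h b hb => ?_, fun h y hy => ?_⟩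
  · -- the projection of `b` onto `H(Θ)` differs from `b` by a vector in the closure of `G_Θ`
    set y : R.Theta.modelSpace := R.Theta.modelSpace.orthogonalProjectionOnto b
    have hy : b - y ∈ R.Theta.modelSpaceᗮ :=
      Submodule.sub_starProjection_mem_orthogonal b
    have hyb : y ∈ R.flag i.castSucc := by
      rw [mem_flag_iff]
      have := (R.factor.bigSpace i.castSucc).sub_mem hb
        (R.factor.modelSpace_orthogonal_le_bigSpace R.regular i.castSucc hy)
      rwa [sub_sub_cancel] at this
    have h1 : ⟪b - y, (x : R.Theta.Ambient)⟫_ℂ = 0 := (Submodule.mem_orthogonal' _ _).1 hy _ x.2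
    have h2 : ⟪(y : R.Theta.Ambient), (x : R.Theta.Ambient)⟫_ℂ = 0 := h y hyb
    rw [inner_sub_left, h2, sub_zero] at h1
    exact h1
  · exact h _ ((R.mem_flag_iff _ _).1 hy)

lemma entry_eq_zero (R : RegularFactorization n k E) (j : Fin n) {i l : Fin k} (h : l < i) :
    R.entry j i l = 0 := by
  refine compression_eq_zero _ fun x hx => (Submodule.mem_orthogonal' _ _).2 fun y hy => ?_
  exact (Submodule.mem_orthogonal _ _).1 hy.2 _
    (R.monotone_flag (Fin.succ_le_castSucc_iff.2 h) (R.model_mem_flag _ j hx.1))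

/-! ### The diagonal blocks -/

/-- The isometry
`f ⊕ d ↦ Θ_k ⋯ Θ_{i+2} f ⊕ Z_k* (Δ_k Θ_{k-1} ⋯ Θ_{i+2} f ⊕ ⋯ ⊕ Δ_{i+2} f ⊕ d ⊕ 0 ⊕ ⋯ ⊕ 0)`,
with `d` in the defect space of `Θ_{i+1} = R.factor i`, from the ambient space of this factor to that
of the product `Θ`. -/
def factorMap (R : RegularFactorization n k E) (i : Fin k) :
    (R.factor i).Ambient →ₗᵢ[ℂ] R.Theta.Ambient where
  toLinearMap := R.factor.bigMap i.succ ∘ₗ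
    LinearMap.prodMap LinearMap.id
      (LinearMap.single ℂ (fun i => DefectSpace (R.factor i).toCLM) i) ∘ₗ
    (HSum.mk (Fock n (E i.succ)) (DefectSpace (R.factor i).toCLM)).symm.toLinearMap
  norm_map' x := by
    obtain ⟨⟨f, d⟩, rfl⟩ :=
      (HSum.mk (Fock n (E i.succ)) (DefectSpace (R.factor i).toCLM)).surjective x
    rw [← sq_eq_sq₀ (norm_nonneg _) (norm_nonneg _)]
    refine (R.factor.norm_bigMap_sq R.regular i.succ f (Pi.single i d)
      (R.factor.single_mem_freeSpace i d)).trans ?_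
    rw [HSum.norm_mk_sq, Finset.sum_eq_single i]
    · rw [Pi.single_eq_same]
    · intro l _ hl
      rw [Pi.single_eq_of_ne hl]
      simp
    · simp

lemma factorMap_mk (R : RegularFactorization n k E) (i : Fin k) (f : Fock n (E i.succ))
    (d : DefectSpace (R.factor i).toCLM) :
    R.factorMap i (HSum.mk _ _ (f, d)) = R.factor.bigMap i.succ (f, Pi.single i d) := rfl

lemma factorMap_ambientShift (R : RegularFactorization n k E) (i : Fin k) (j : Fin n)
    (x : (R.factor i).Ambient) :
    R.factorMap i ((R.factor i).ambientShift j x) =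
      R.Theta.ambientShift j (R.factorMap i x) := by
  obtain ⟨⟨f, d⟩, rfl⟩ :=
    (HSum.mk (Fock n (E i.succ)) (DefectSpace (R.factor i).toCLM)).surjective x
  rw [Op.ambientShift_mk, factorMap_mk, factorMap_mk, R.factor.ambientShift_bigMap R.regular,
    Chain.sumShift_single]

/-- The subspace `0 ⊕ Z_k* (0 ⊕ ⋯ ⊕ 0 ⊕ g_i ⊕ ⋯ ⊕ g_1)` shared by `bigSpace i.castSucc` and
`bigSpace i.succ`. -/
def tailSpace (R : RegularFactorization n k E) (i : Fin k) : Submodule ℂ R.Theta.Ambient :=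
  (R.factor.freeSpace i.castSucc).map
    (R.factor.bigMap i.castSucc ∘ₗ LinearMap.inr ℂ (Fock n (E i.castSucc)) _)

lemma inner_factorMap_of_mem_tailSpace (R : RegularFactorization n k E) (i : Fin k)
    (x : (R.factor i).Ambient) {r : R.Theta.Ambient} (hr : r ∈ R.tailSpace i) :
    ⟪R.factorMap i x, r⟫_ℂ = 0 := by
  obtain ⟨⟨f, d⟩, rfl⟩ :=
    (HSum.mk (Fock n (E i.succ)) (DefectSpace (R.factor i).toCLM)).surjective x
  obtain ⟨g, hg, rfl⟩ := hr
  change ⟪R.factor.bigMap i.succ (f, Pi.single i d), R.factor.bigMap i.castSucc (0, g)⟫_ℂ = 0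
  rw [Chain.bigMap_apply, Chain.bigMap_apply, HSum.inner_mk, map_zero, inner_zero_right, zero_add,
    ContinuousLinearMap.adjoint_inner_left, R.factor.Z_Z_adjoint R.regular, map_zero, zero_add,
    HPi.inner_mk]
  refine Finset.sum_eq_zero fun l _ => ?_
  by_cases h : i.castSucc ≤ l.castSucc
  · rw [hg l h, inner_zero_right]
  · have hl : l < i := Fin.castSucc_lt_castSucc_iff.1 (not_le.1 h)
    rw [Pi.add_apply, Pi.single_eq_of_ne hl.ne, R.factor.defectFam_of_not_le _ _ _
      (not_le.2 ((not_le.1 h).trans Fin.castSucc_lt_succ)), add_zero, inner_zero_left]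

lemma tailSpace_le (R : RegularFactorization n k E) (i : Fin k) :
    R.tailSpace i ≤ R.factor.bigSpace i.castSucc := by
  rintro _ ⟨g, hg, rfl⟩
  exact ⟨(0, g), ⟨trivial, hg⟩, rfl⟩

lemma factorMap_mem_bigSpace (R : RegularFactorization n k E) (i : Fin k)
    (x : (R.factor i).Ambient) : R.factorMap i x ∈ R.factor.bigSpace i.succ := by
  obtain ⟨⟨f, d⟩, rfl⟩ :=
    (HSum.mk (Fock n (E i.succ)) (DefectSpace (R.factor i).toCLM)).surjective x
  rw [factorMap_mk]
  exact ⟨(f, Pi.single i d), ⟨trivial, R.factor.single_mem_freeSpace i d⟩, rfl⟩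

/-- A decomposition that exhibits `bigSpace i.castSucc` as the sum of the image of the graph
of the factor `R.factor i` and of the tail space. -/
lemma bigMap_castSucc_eq (R : RegularFactorization n k E) (i : Fin k) (f : Fock n (E i.castSucc))
    (g : ∀ i, DefectSpace (R.factor i).toCLM) :
    R.factor.bigMap i.castSucc (f, g) = R.factorMap i ((R.factor i).graphMap f) +
      R.factor.bigMap i.castSucc (0, g) := by
  have h : R.factorMap i ((R.factor i).graphMap f) = R.factor.bigMap i.succ
      ((R.factor i).toCLM f, Pi.single i (defectMap (R.factor i).toCLM f)) := rfl
  rw [h, R.factor.bigMap_zero_left i.castSucc i.succ, ← map_add, Chain.bigMap_castSucc,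
    Prod.mk_add_mk, add_zero]

/-- `bigSpace i.succ` is the sum of the range of `factorMap i` and of the tail space. -/
lemma exists_eq_factorMap_add (R : RegularFactorization n k E) (i : Fin k) {x : R.Theta.Ambient}
    (hx : x ∈ R.factor.bigSpace i.succ) :
    ∃ y, ∃ r ∈ R.tailSpace i, x = R.factorMap i y + r := by
  obtain ⟨⟨f, g⟩, ⟨_, hg⟩, rfl⟩ := hx
  change g ∈ R.factor.freeSpace i.succ at hg
  have hg' : g - Pi.single i (g i) ∈ R.factor.freeSpace i.castSucc := by
    intro l hl
    rcases (Fin.castSucc_le_castSucc_iff.1 hl).eq_or_lt with rfl | h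
    · rw [Pi.sub_apply, Pi.single_eq_same, sub_self]
    · rw [Pi.sub_apply, Pi.single_eq_of_ne h.ne', hg l (Fin.succ_le_castSucc_iff.2 h), sub_zero]
  refine ⟨HSum.mk _ _ (f, g i), _, ⟨_, hg', rfl⟩, ?_⟩
  rw [factorMap_mk, LinearMap.comp_apply, LinearMap.inr_apply,
    R.factor.bigMap_zero_left i.castSucc i.succ, ← map_add, Prod.mk_add_mk, add_zero,
    add_sub_cancel]

lemma factorMap_mem_orthogonal_iff (R : RegularFactorization n k E) (i : Fin k)
    (x : (R.factor i).Ambient) :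
    R.factorMap i x ∈ (R.factor.bigSpace i.castSucc)ᗮ ↔ x ∈ (R.factor i).modelSpace := by
  rw [Op.modelSpace, Submodule.mem_orthogonal', Submodule.mem_orthogonal']
  constructor
  · rintro h _ ⟨f, rfl⟩
    rw [← (R.factorMap i).inner_map_map]
    refine h _ ⟨(f, 0), ⟨trivial, Submodule.zero_mem _⟩, ?_⟩
    rw [bigMap_castSucc_eq, ← Prod.zero_eq_mk, map_zero, add_zero]
  · rintro h _ ⟨⟨f, g⟩, ⟨_, hg⟩, rfl⟩
    rw [bigMap_castSucc_eq, inner_add_right, (R.factorMap i).inner_map_map, h _ ⟨f, rfl⟩, zero_add]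
    exact R.inner_factorMap_of_mem_tailSpace i x ⟨g, hg, rfl⟩

lemma factorMap_mem_modelSpace (R : RegularFactorization n k E) (i : Fin k)
    (x : (R.factor i).modelSpace) : R.factorMap i x ∈ R.Theta.modelSpace :=
  Submodule.orthogonal_le (R.factor.graph_le_bigSpace R.regular i.castSucc)
    ((R.factorMap_mem_orthogonal_iff i x).2 x.2)

/-- The isometry `factorMap i`, as a unitary from the model space of the factor
`R.factor i` onto the difference space. -/
def factorEquiv (R : RegularFactorization n k E) (i : Fin k) :
    (R.factor i).modelSpace ≃ₗᵢ[ℂ] R.block i :=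
  LinearIsometryEquiv.ofSurjective
    { toLinearMap := LinearMap.codRestrict (R.block i)
        (LinearMap.codRestrict R.Theta.modelSpace
          ((R.factorMap i).toLinearMap ∘ₗ (R.factor i).modelSpace.subtype)
          (R.factorMap_mem_modelSpace i))
        fun x => (R.mem_block_iff i _).2
          ⟨R.factorMap_mem_bigSpace i x, (R.factorMap_mem_orthogonal_iff i x).2 x.2⟩
      norm_map' := fun x => (R.factorMap i).norm_map x } <| by
    rintro ⟨⟨x, hxH⟩, hx⟩
    obtain ⟨h1, h2⟩ := (R.mem_block_iff i _).1 hx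
    obtain ⟨y, r, hr, hxy⟩ := R.exists_eq_factorMap_add i h1
    -- the tail part of `x` is orthogonal to `x` and to `factorMap i y`, hence vanishes
    have h3 : ⟪x, r⟫_ℂ = 0 := (Submodule.mem_orthogonal' _ _).1 h2 r (R.tailSpace_le i hr)
    change x = _ at hxy
    rw [hxy, inner_add_left, R.inner_factorMap_of_mem_tailSpace i y hr, zero_add] at h3
    rw [inner_self_eq_zero.1 h3, add_zero] at hxy
    subst hxy
    exact ⟨⟨y, (R.factorMap_mem_orthogonal_iff i y).1 h2⟩, rfl⟩

/-- Both sides are compressions of the isometric dilations, which `factorMap i` intertwines. -/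
lemma diag_factorEquiv (R : RegularFactorization n k E) (i : Fin k) (j : Fin n)
    (x : (R.factor i).modelSpace) :
    R.diag i j (R.factorEquiv i x) = R.factorEquiv i ((R.factor i).model j x) := by
  refine ext_inner_right ℂ fun y => ?_
  obtain ⟨z, rfl⟩ := (R.factorEquiv i).surjective y
  refine (inner_compression (R.block i) (R.Theta.model j) _ _).trans ?_
  refine (R.Theta.inner_model j _ _).trans ?_
  refine Eq.trans ?_
    ((R.factorMap i).inner_map_map ((R.factor i).model j x : (R.factor i).Ambient) z).symm
  refine Eq.trans ?_ ((R.factor i).inner_model j x z).symm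
  rw [← (R.factorMap i).inner_map_map, factorMap_ambientShift]
  rfl

lemma unitarilyEquivalent_diag (R : RegularFactorization n k E) (i : Fin k) :
    UnitarilyEquivalent (H := R.block i) (K := (R.factor i).modelSpace)
      (R.diag i) (R.factor i).model := by
  refine ⟨(R.factorEquiv i).symm, fun j x => (R.factorEquiv i).injective ?_⟩
  rw [← diag_factorEquiv]
  refine ((R.factorEquiv i).apply_symm_apply _).trans ?_
  exact congrArg (R.diag i j) ((R.factorEquiv i).apply_symm_apply x).symm

lemma isRowContraction_diag (R : RegularFactorization n k E) (i : Fin k) :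
    IsRowContraction (H := R.block i) (R.diag i) :=
  isRowContraction_compression _ _ R.Theta.sum_norm_adjoint_model_sq_le

end RegularFactorization

end Chain

end MultiAnalytic

end

theorem mainTheorem3 {n k : ℕ} (hk : 2 ≤ k) {E : Fin (k + 1) → Type*}
    [∀ i, NormedAddCommGroup (E i)] [∀ i, InnerProductSpace ℂ (E i)] [∀ i, CompleteSpace (E i)]
    (R : MultiAnalytic.RegularFactorization n k E)
    (hpure : R.Theta.PurelyContractive) (hSzego : R.Theta.Szego) :
    -- the model row contraction and the chain of joint invariant subspaces
    MultiAnalytic.IsRowContraction (H := R.Theta.modelSpace) R.Theta.model ∧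
    (∀ a : Fin (k + 1), IsClosed (R.flag a : Set R.Theta.modelSpace)) ∧
    Monotone R.flag ∧
    (∀ (a : Fin (k + 1)) (j : Fin n), ∀ x ∈ R.flag a, R.Theta.model j x ∈ R.flag a) ∧
    -- the orthogonal decomposition of the model space
    OrthogonalFamily ℂ (fun i : Fin k => R.block i) (fun i => (R.block i).subtypeₗᵢ) ∧
    DirectSum.IsInternal R.block ∧
    -- the upper triangular form
    (∀ (j : Fin n) (i l : Fin k), l < i → R.entry j i l = 0) ∧
    -- the diagonal blocks
    ∀ i : Fin k,
      MultiAnalytic.IsRowContraction (H := R.block i) (R.diag i) ∧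
      MultiAnalytic.UnitarilyEquivalent (H := R.block i) (K := (R.factor i).modelSpace)
        (R.diag i) (R.factor i).model := by
  refine ⟨R.Theta.isRowContraction_model, R.isClosed_flag, R.monotone_flag,
    fun a j x hx => R.model_mem_flag a j hx,
    MultiAnalytic.orthogonalFamily_of_flag R.flag R.monotone_flag,
    MultiAnalytic.isInternal_of_flag R.flag R.monotone_flag R.isClosed_flag R.flag_zero R.flag_last,
    fun j i l h => R.entry_eq_zero j h,
    fun i => ⟨R.isRowContraction_diag i, R.unitarilyEquivalent_diag i⟩⟩
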